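/- Let $k$ be an algebraically closed field of characteristic zero and let $H$ be a Hopf algebra over $k$ with comultiplication $\Delta$. Let $G(H)$ be the group of group-like elements of $H$, and let $C_0=kG(H)$ be its linear span, a subalgebra of $H$. A nonzero element $y\in H$ is called skew primitive of weight $\mu(y)=g\in G(H)$ if $\Delta(y)=y\otimes 1+g\otimes y$. Let $W\subseteq G(H)$ be the set of the weights $\mu(y)$ of all skew primitive elements $y\notin C_0$. Let $W_{\sqrt{\;}}\subseteq W$ be the set of the weights $\mu(y)$ of those skew primitive elements $y\notin C_0$ for which there is an $n>1$ such that $y^n$ is zero or is again skew primitive (of some weight). For a skew primitive $y\notin C_0$, if there is a scalar $c\in k^\times$ with $\mu(y)^{-1}y\,\mu(y)-cy\in C_0$, then this (unique) $c$ is called the commutator of $y$ and is denoted by $\gamma(y)$. Let $\Omega\subseteq G(H)\times k^\times$ be the set of the pairs $(\mu(y),\gamma(y))$ for all skew primitive $y\notin C_0$ whose commutator exists, and let $\Omega_{\sqrt{\;}}\subseteq\Omega$ be the subset of those pairs whose second entry is a root of unity different from $1$. For a $k$-algebra $A$, let $\operatorname{GKdim}A=\sup_V\limsup_{n\to\infty}\log_n\dim_k\big(\sum_{i=0}^n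 V^i\big)\in[0,\infty]$ be its Gelfand–Kirillov dimension, where $V$ runs over all finite-dimensional subspaces of $A$. Write $\#S\in\{0,1,2,\dots\}\cup\{\infty\}$ for the number of elements of a set $S$. Theorem (second lower bound theorem). Suppose that the subgroup $\langle W\setminus W_{\sqrt{\;}}\rangle$ of $G(H)$ generated by $W\setminus W_{\sqrt{\;}}$ is abelian. Then $$\operatorname{GKdim}H\ \ge\ \operatorname{GKdim}C_0+\#(W\setminus W_{\sqrt{\;}})$$ and $$\operatorname{GKdim}H\ \ge\ \operatorname{GKdim}C_0+\#(\Omega\setminus\Omega_{\sqrt{\;}}).$$ -/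

import Mathlib

open scoped TensorProduct ENNReal

namespace SkewPrim

section GKdim

variable (k : Type*) [Field k] (A : Type*) [Ring A] [Algebra k A]

/-- The Gelfand-Kirillov dimension of a (not necessarily finitely generated) `k`-algebra `A`:
the supremum, over all finite-dimensional subspaces `V` of `A`, of
`limsup_n log_n dim (k + V + V ^ 2 + ⋯ + V ^ n)`. It takes values in `[0, ∞]`. -/
noncomputable def gkDim : ℝ≥0∞ :=
  ⨆ (V : Submodule k A) (_ : V.FG),
    Filter.limsup
      (fun n : ℕ => ENNReal.ofReal
        (Real.logb n (Module.finrank k ↥(∑ i ∈ Finset.range (n + 1), V ^ i))))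
      Filter.atTop

end GKdim

section Hopf

variable (k : Type*) [Field k] (H : Type*) [Ring H] [HopfAlgebra k H]

/-- `C₀ = kG(H)`: the linear span of the group-like elements, as a subalgebra of `H`. The
subalgebra generated by the group-like elements is their span, see `toSubmodule_groupSpan`. -/
def groupSpan : Subalgebra k H :=
  Algebra.adjoin k {a : H | IsGroupLikeElem k a}

theorem toSubmodule_groupSpan :
    Subalgebra.toSubmodule (groupSpan k H) = Submodule.span k {a : H | IsGroupLikeElem k a} := by
  have h : ((groupLikeSubmonoid k H : Submonoid H) : Set H) = {a : H | IsGroupLikeElem k a} := rfl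
  rw [groupSpan, Algebra.adjoin_eq_span, ← h, Submonoid.closure_eq]

variable {k H}

/-- `Δ(y) = y ⊗ 1 + g ⊗ y`. The zero element satisfies this for every `g`; a nonzero such `y`
is a skew primitive element of weight `g`. -/
def IsPrimitiveAt (g : GroupLike k H) (y : H) : Prop :=
  Coalgebra.comul (R := k) y = y ⊗ₜ[k] (1 : H) + (g : H) ⊗ₜ[k] y

variable (k H)

/-- `W`: the weights of the skew primitive elements which do not lie in `C₀`
(such elements are automatically nonzero). -/
def weights : Set (GroupLike k H) :=
  {g | ∃ y : H, IsPrimitiveAt g y ∧ y ∉ groupSpan k H}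

/-- `W_√`: the weights of those skew primitive elements `y`, not in `C₀`, some power `y ^ n` of
which, `n > 1`, is again skew primitive (of some weight) or zero. -/
def sqrtWeights : Set (GroupLike k H) :=
  {g | ∃ y : H, IsPrimitiveAt g y ∧ y ∉ groupSpan k H ∧
    ∃ n : ℕ, 1 < n ∧ ∃ h : GroupLike k H, IsPrimitiveAt h (y ^ n)}

/-- `Ω`: the pairs `(μ(y), γ(y))`, where `y ∉ C₀` is a skew primitive element of weight `μ(y)`
whose commutator `γ(y)` exists. The commutator is the (unique) scalar `c ∈ kˣ` such that
`μ(y)⁻¹ y μ(y) - c y ∈ C₀`. -/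
def weightCommutators : Set (GroupLike k H × kˣ) :=
  {p | ∃ y : H, IsPrimitiveAt p.1 y ∧ y ∉ groupSpan k H ∧
    ((p.1⁻¹ : GroupLike k H) : H) * y * (p.1 : H) - (p.2 : k) • y ∈ groupSpan k H}

/-- `Ω_√`: the pairs in `Ω` whose second component is a root of unity different from `1`. -/
def sqrtWeightCommutators : Set (GroupLike k H × kˣ) :=
  {p | p ∈ weightCommutators k H ∧ p.2 ≠ 1 ∧ ∃ n : ℕ, 0 < n ∧ p.2 ^ n = 1}

end Hopf

end SkewPrim

/-! The second inequality carries the proof. Choose finitely many pairs in `Ω ∖ Ω_√` and skew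
primitive elements `y_i` realising them; these are independent modulo `C₀`, since left slices
separate the weights and, within one weight, commutators are distinct eigenvalues of conjugation. It
suffices that ordered monomials in the `y_i`, multiplied by group-likes, are linearly independent
(`linearIndependent_mon_mul_coe`): then each `y_i` adds one to the growth exponent of `C₀`
(`gkDim_groupSpan_add_le`). No straightening relations between the `y_i` are needed.

Independence comes from differentiation. Let a functional vanish on `C₀`, take the value 1 at `y_j`
and kill the other `y_i`. Applied to the right factor of `Δ`, it acts, up to lower filtration order,
as a `q`-derivative in `y_j`, sending `y_j ^ (b + 1)` to `(1 + γ⁻¹ + ⋯ + γ⁻ᵇ) y_j ^ b g_j`. In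
characteristic zero these sums are nonzero unless `γ` is a root of unity different from 1.

The first inequality reduces to the second when `GKdim H` is finite. Let `g ∈ W ∖ W_√` be the weight
of `y`. If the classes of the conjugates of `y` by powers of `g` were independent modulo `C₀`, their
squarefree monomials would grow faster than any polynomial (`gkDim_eq_top_of_conj_pow`). So some
polynomial in the conjugation kills the class of `y`, and an eigenvector gives a commutator. It is
not a root of unity other than 1, for otherwise the `q`-binomial theorem would put `g` in `W_√`
(`mem_sqrtWeights`). Hence `W ∖ W_√` lies in the projection of `Ω ∖ Ω_√`. -/

namespace SkewPrim

/-! ### Slices of the comultiplication and the filtration over `kG(H)` -/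

section Filtration

variable {k : Type*} [Field k] {H : Type*} [Ring H] [HopfAlgebra k H]

theorem coe_inv_mul (g : GroupLike k H) : ((g⁻¹ : GroupLike k H) : H) * (g : H) = 1 := by
  rw [← GroupLike.val_mul, inv_mul_cancel, GroupLike.val_one]

theorem coe_mul_inv (g : GroupLike k H) : (g : H) * ((g⁻¹ : GroupLike k H) : H) = 1 := by
  rw [← GroupLike.val_mul, mul_inv_cancel, GroupLike.val_one]

theorem coe_mem_groupSpan (g : GroupLike k H) : (g : H) ∈ groupSpan k H :=
  Algebra.subset_adjoin g.isGroupLikeElem_val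

theorem groupSpan_induction {p : H → Prop} (hg : ∀ g : GroupLike k H, p (g : H)) (h0 : p 0)
    (hadd : ∀ x y, p x → p y → p (x + y)) (hsmul : ∀ (c : k) x, p x → p (c • x))
    {u : H} (hu : u ∈ groupSpan k H) : p u := by
  rw [← Subalgebra.mem_toSubmodule, toSubmodule_groupSpan] at hu
  induction hu using Submodule.span_induction with
  | mem x h => exact hg ⟨x, h⟩
  | zero => exact h0
  | add x y _ _ hx hy => exact hadd x y hx hy
  | smul c x _ hx => exact hsmul c x hx

/-- The right coaction operator `(id ⊗ φ) ∘ Δ` of a functional `φ`. -/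
noncomputable def slice (φ : Module.Dual k H) : H →ₗ[k] H :=
  (TensorProduct.rid k H).toLinearMap ∘ₗ φ.lTensor H ∘ₗ Coalgebra.comul

/-- The functionals vanishing on the span of the group-like elements. -/
def annC0 (f : Module.Dual k H) : Prop := ∀ u ∈ groupSpan k H, f u = 0

theorem annC0_iff {f : Module.Dual k H} : annC0 f ↔ ∀ g : GroupLike k H, f (g : H) = 0 :=
  ⟨fun h g => h _ (coe_mem_groupSpan g), fun h u hu => groupSpan_induction (p := fun u => f u = 0)
    h (map_zero f) (fun x y hx hy => by simp [hx, hy]) (fun c x hx => by simp [hx]) hu⟩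

theorem slice_coe (φ : Module.Dual k H) (g : GroupLike k H) :
    slice φ (g : H) = φ (g : H) • (g : H) := by
  simp [slice]

theorem slice_one (φ : Module.Dual k H) : slice φ (1 : H) = φ 1 • (1 : H) := by
  simpa using slice_coe φ (1 : GroupLike k H)

theorem slice_coe_mul (φ : Module.Dual k H) (g : GroupLike k H) (u : H) :
    slice φ (g * u) = g * slice (φ ∘ₗ LinearMap.mulLeft k (g : H)) u := by
  simp only [slice, LinearMap.comp_apply, Bialgebra.comul_mul]
  rw [g.isGroupLikeElem_val.comul_eq_tmul_self]
  induction Coalgebra.comul (R := k) u using TensorProduct.induction_on with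
  | zero => simp
  | tmul x y => simp
  | add x y hx hy => simp only [mul_add, map_add, hx, hy]

theorem slice_mul_coe (φ : Module.Dual k H) (g : GroupLike k H) (u : H) :
    slice φ (u * g) = slice (φ ∘ₗ LinearMap.mulRight k (g : H)) u * g := by
  simp only [slice, LinearMap.comp_apply, Bialgebra.comul_mul]
  rw [g.isGroupLikeElem_val.comul_eq_tmul_self]
  induction Coalgebra.comul (R := k) u using TensorProduct.induction_on with
  | zero => simp
  | tmul x y => simp
  | add x y hx hy => simp only [add_mul, map_add, hx, hy]

theorem IsPrimitiveAt.slice {g : GroupLike k H} {p : H} (hp : IsPrimitiveAt g p)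
    (φ : Module.Dual k H) : slice φ p = φ 1 • p + φ p • (g : H) := by
  rw [IsPrimitiveAt] at hp
  simp [SkewPrim.slice, hp]

theorem IsPrimitiveAt.slice_mul {g : GroupLike k H} {p : H} (hp : IsPrimitiveAt g p)
    (φ : Module.Dual k H) (u : H) :
    SkewPrim.slice φ (p * u) =
      p * SkewPrim.slice φ u + g * SkewPrim.slice (φ ∘ₗ LinearMap.mulLeft k p) u := by
  rw [IsPrimitiveAt] at hp
  simp only [SkewPrim.slice, LinearMap.comp_apply, Bialgebra.comul_mul, hp]
  induction Coalgebra.comul (R := k) u using TensorProduct.induction_on with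
  | zero => simp
  | tmul x y => simp [add_mul]
  | add x y hx hy =>
    simp only [mul_add, map_add, hx, hy]
    abel

/-- The convolution `(f ⊗ φ) ∘ Δ` of two functionals. -/
noncomputable def conv (f φ : Module.Dual k H) : Module.Dual k H := f ∘ₗ slice φ

/-- This is coassociativity. With `annC0_conv` it shows that arbitrary slices preserve each `filt
d`. -/
theorem slice_slice (f φ : Module.Dual k H) (u : H) :
    slice f (slice φ u) = slice (conv f φ) u := by
  have key : ∀ t : H ⊗[k] H,
      slice f (TensorProduct.rid k H (φ.lTensor H t)) =
        TensorProduct.rid k H (f.lTensor H (TensorProduct.rid k (H ⊗[k] H)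
          (φ.lTensor (H ⊗[k] H) ((Coalgebra.comul (R := k)).rTensor H t)))) := by
    intro t
    induction t using TensorProduct.induction_on with
    | zero => simp
    | tmul x y => simp [slice]
    | add x y hx hy => simp only [map_add, hx, hy]
  have key2 : ∀ t : H ⊗[k] (H ⊗[k] H),
      TensorProduct.rid k H (f.lTensor H (TensorProduct.rid k (H ⊗[k] H)
          (φ.lTensor (H ⊗[k] H) ((TensorProduct.assoc k H H H).symm t)))) =
        TensorProduct.rid k H
          ((f ∘ₗ (TensorProduct.rid k H).toLinearMap ∘ₗ φ.lTensor H).lTensor H t) := by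
    intro t
    induction t using TensorProduct.induction_on with
    | zero => simp
    | add x y hx hy => simp only [map_add, hx, hy]
    | tmul x y =>
      induction y using TensorProduct.induction_on with
      | zero => simp
      | add y z hy hz => simp only [map_add, TensorProduct.tmul_add, hy, hz]
      | tmul y z => simp [mul_smul]
  have h1 := key (Coalgebra.comul (R := k) u)
  rw [← Coalgebra.coassoc_symm_apply, key2] at h1
  have h2 : slice f (slice φ u) =
    slice f (TensorProduct.rid k H (φ.lTensor H (Coalgebra.comul (R := k) u))) := rfl
  rw [h2, h1, ← LinearMap.comp_apply (LinearMap.lTensor H _) , ← LinearMap.lTensor_comp]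
  rfl

theorem annC0_conv {f : Module.Dual k H} (hf : annC0 f) (φ : Module.Dual k H) :
    annC0 (conv f φ) := by
  rw [annC0_iff] at hf ⊢
  intro g
  simp [conv, slice_coe, hf g]

theorem annC0_mulLeft {f : Module.Dual k H} (hf : annC0 f) (g : GroupLike k H) :
    annC0 (f ∘ₗ LinearMap.mulLeft k (g : H)) := fun _ hu =>
  hf _ ((groupSpan k H).mul_mem (coe_mem_groupSpan g) hu)

theorem annC0_mulRight {f : Module.Dual k H} (hf : annC0 f) (g : GroupLike k H) :
    annC0 (f ∘ₗ LinearMap.mulRight k (g : H)) := fun _ hu =>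
  hf _ ((groupSpan k H).mul_mem hu (coe_mem_groupSpan g))

variable (k H) in
/-- The coradical filtration relative to the span of the group-like elements, shifted by one:
`filt 0 = 0`, and `filt (d + 1)` consists of the `u` with `(id ⊗ f) Δ u ∈ filt d` for all
functionals `f` vanishing on the group-like elements. -/
noncomputable def filt : ℕ → Submodule k H
  | 0 => ⊥
  | d + 1 => ⨅ (f : Module.Dual k H) (_ : annC0 f), (filt d).comap (slice f)

theorem filt_zero : filt k H 0 = ⊥ := rfl

theorem mem_filt_succ {d : ℕ} {u : H} :
    u ∈ filt k H (d + 1) ↔ ∀ f : Module.Dual k H, annC0 f → slice f u ∈ filt k H d := by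
  simp [filt]

theorem filt_le_succ (d : ℕ) : filt k H d ≤ filt k H (d + 1) := by
  induction d with
  | zero => simp [filt_zero]
  | succ d ih => exact fun u hu => mem_filt_succ.2 fun f hf => ih (mem_filt_succ.1 hu f hf)

theorem filt_mono : Monotone (filt k H) := monotone_nat_of_le_succ filt_le_succ

theorem slice_mem_filt (φ : Module.Dual k H) {d : ℕ} {u : H} (hu : u ∈ filt k H d) :
    slice φ u ∈ filt k H d := by
  cases d with
  | zero => simp_all [filt_zero]
  | succ d =>
    refine mem_filt_succ.2 fun f hf => ?_
    rw [slice_slice]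
    exact mem_filt_succ.1 hu _ (annC0_conv hf φ)

theorem coe_mul_mem_filt (g : GroupLike k H) {d : ℕ} {u : H} (hu : u ∈ filt k H d) :
    (g : H) * u ∈ filt k H d := by
  induction d generalizing u with
  | zero => simp_all [filt_zero]
  | succ d ih =>
    refine mem_filt_succ.2 fun f hf => ?_
    rw [slice_coe_mul]
    exact ih (mem_filt_succ.1 hu _ (annC0_mulLeft hf g))

theorem mul_coe_mem_filt (g : GroupLike k H) {d : ℕ} {u : H} (hu : u ∈ filt k H d) :
    u * (g : H) ∈ filt k H d := by
  induction d generalizing u with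
  | zero => simp_all [filt_zero]
  | succ d ih =>
    refine mem_filt_succ.2 fun f hf => ?_
    rw [slice_mul_coe]
    exact ih (mem_filt_succ.1 hu _ (annC0_mulRight hf g))

theorem groupSpan_mul_mem_filt {c : H} (hc : c ∈ groupSpan k H) {d : ℕ} {u : H}
    (hu : u ∈ filt k H d) : c * u ∈ filt k H d :=
  groupSpan_induction (p := fun c => c * u ∈ filt k H d) (fun g => coe_mul_mem_filt g hu)
    (by simp) (fun x y hx hy => by simpa [add_mul] using add_mem hx hy)
    (fun a x hx => by simpa using Submodule.smul_mem _ a hx) hc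

theorem IsPrimitiveAt.mul_mem_filt {g : GroupLike k H} {p : H} (hp : IsPrimitiveAt g p)
    {d : ℕ} {u : H} (hu : u ∈ filt k H d) : p * u ∈ filt k H (d + 1) := by
  induction d generalizing u with
  | zero => simp_all [filt_zero]
  | succ d ih =>
    refine mem_filt_succ.2 fun f hf => ?_
    rw [hp.slice_mul]
    exact add_mem (ih (mem_filt_succ.1 hu f hf)) (coe_mul_mem_filt g (slice_mem_filt _ hu))

theorem IsPrimitiveAt.pow_mul_mem_filt {g : GroupLike k H} {p : H} (hp : IsPrimitiveAt g p)
    {d : ℕ} {u : H} (hu : u ∈ filt k H d) (b : ℕ) : p ^ b * u ∈ filt k H (d + b) := by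
  induction b with
  | zero => simpa
  | succ b ih =>
    rw [pow_succ', mul_assoc]
    exact hp.mul_mem_filt ih

variable (k) in
/-- The elements whose comultiplication is `u ⊗ 1` up to terms with left factor in `filt d`. -/
def lead (d : ℕ) (u : H) : Prop :=
  ∀ φ : Module.Dual k H, slice φ u - φ 1 • u ∈ filt k H d

theorem lead_one : lead k 0 (1 : H) := fun φ => by simp [slice_one, filt_zero]

theorem lead.mem_filt {d : ℕ} {u : H} (hu : lead k d u) : u ∈ filt k H (d + 1) :=
  mem_filt_succ.2 fun f hf => by
    simpa [hf 1 (one_mem _)] using hu f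

theorem lead.mul {g : GroupLike k H} {p : H} (hp : IsPrimitiveAt g p) {d : ℕ} {u : H}
    (hu : lead k d u) : lead k (d + 1) (p * u) := by
  intro φ
  have h : SkewPrim.slice φ (p * u) - φ 1 • (p * u) =
      p * (SkewPrim.slice φ u - φ 1 • u) +
        g * SkewPrim.slice (φ ∘ₗ LinearMap.mulLeft k p) u := by
    rw [hp.slice_mul, mul_sub, mul_smul_comm]
    abel
  rw [h]
  exact add_mem (hp.mul_mem_filt (hu φ)) (coe_mul_mem_filt g (slice_mem_filt _ hu.mem_filt))

theorem lead.pow_mul {g : GroupLike k H} {p : H} (hp : IsPrimitiveAt g p) {d : ℕ} {u : H}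
    (hu : lead k d u) (b : ℕ) : lead k (d + b) (p ^ b * u) := by
  induction b with
  | zero => simpa
  | succ b ih =>
    rw [pow_succ', mul_assoc]
    exact ih.mul hp

theorem lead_pow {g : GroupLike k H} {p : H} (hp : IsPrimitiveAt g p) (b : ℕ) :
    lead k b (p ^ b) := by
  simpa using lead_one.pow_mul hp b

/-- A Leibniz rule up to lower order: the last term of `IsPrimitiveAt.slice_mul` is `g` times a
slice of `u`, and `lead` identifies that slice with `f p • u` modulo `filt d`. -/
theorem lead.slice_mul_sub {g : GroupLike k H} {p : H} (hp : IsPrimitiveAt g p) {d : ℕ} {u : H}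
    (hu : lead k d u) (f : Module.Dual k H) :
    slice f (p * u) - p * slice f u - f p • (g * u) ∈ filt k H d := by
  have h : SkewPrim.slice f (p * u) - p * SkewPrim.slice f u - f p • (g * u) =
      g * (SkewPrim.slice (f ∘ₗ LinearMap.mulLeft k p) u -
        (f ∘ₗ LinearMap.mulLeft k p) 1 • u) := by
    rw [hp.slice_mul, mul_sub, mul_smul_comm]
    simp
  rw [h]
  exact coe_mul_mem_filt g (hu _)

theorem lead.slice_mul_coe_sub {d : ℕ} {u : H} (hu : lead k d u) (φ : Module.Dual k H)
    (h : GroupLike k H) : slice φ (u * h) - φ h • (u * h) ∈ filt k H d := by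
  have := mul_coe_mem_filt h (hu (φ ∘ₗ LinearMap.mulRight k (h : H)))
  rw [slice_mul_coe]
  simpa [sub_mul] using this

theorem lead.slice_pow_mul_sub {g : GroupLike k H} {p : H} (hp : IsPrimitiveAt g p) {e : ℕ} {u : H}
    (hu : lead k e u) {f : Module.Dual k H} (hfp : f p = 0) (b m : ℕ) (hm : e + b ≤ m + 1) :
    slice f (p ^ b * u) - p ^ b * slice f u ∈ filt k H m := by
  induction b generalizing m with
  | zero => simp
  | succ b ih =>
    have h1 := (hu.pow_mul hp b).slice_mul_sub hp f
    rw [hfp, zero_smul, sub_zero] at h1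
    have h2 : p * (slice f (p ^ b * u) - p ^ b * slice f u) ∈ filt k H m := by
      -- Multiplication by `p` raises the filtration index, so `m` must be a successor; for `m = 0`
      -- the bound forces `b = 0` and the difference is zero.
      cases m with
      | zero =>
        obtain rfl : b = 0 := by omega
        simp
      | succ m => exact hp.mul_mem_filt (ih m (by omega))
    have h3 := add_mem (filt_mono (by omega : e + b ≤ m) h1) h2
    rw [pow_succ', mul_assoc, mul_assoc]
    convert h3 using 1
    rw [mul_sub]
    abel

end Filtration

/-! ### Linear independence of ordered monomials -/

section Monomials

variable {k : Type*} [Field k] {H : Type*} [Ring H] [HopfAlgebra k H]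

theorem _root_.LinearIndependent.exists_dual_eq_one {V ι : Type*} [AddCommGroup V] [Module k V]
    {v : ι → V} (hv : LinearIndependent k v) (j : ι) :
    ∃ f : Module.Dual k V, f (v j) = 1 ∧ ∀ i, i ≠ j → f (v i) = 0 := by
  have hj : v j ∉ Submodule.span k (v '' {i | i ≠ j}) := by
    apply hv.notMem_span_image
    simp
  obtain ⟨f, hf, hle⟩ := Submodule.exists_le_ker_of_notMem hj
  refine ⟨(f (v j))⁻¹ • f, by simp [hf], fun i hi => ?_⟩
  have : f (v i) = 0 := hle (Submodule.subset_span ⟨i, hi, rfl⟩)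
  simp [this]

/-- The condition that the coefficient of `y ^ b * g` in the derivative of `y ^ (b + 1)` along `y`
does not vanish. -/
def SliceGood (g : GroupLike k H) (y : H) (b : ℕ) : Prop :=
  ∀ f : Module.Dual k H, annC0 f → f y = 1 →
    ∃ c : k, c ≠ 0 ∧ slice f (y ^ (b + 1)) - c • (y ^ b * g) ∈ filt k H b

theorem sliceGood_zero {g : GroupLike k H} {y : H} (hy : IsPrimitiveAt g y) :
    SliceGood g y 0 := fun f hf hfy =>
  ⟨1, one_ne_zero, by simp [hy.slice, hf 1 (one_mem _), hfy]⟩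

/-- Each passage of `g` across a factor `y` costs `γ⁻¹` and an error in `C₀`, which replaces that
factor and so lowers the order. -/
theorem coe_mul_pow_sub {g : GroupLike k H} {y : H} (hy : IsPrimitiveAt g y) {γ : k} (hγ : γ ≠ 0)
    (hc : ((g⁻¹ : GroupLike k H) : H) * y * g - γ • y ∈ groupSpan k H) (b : ℕ) :
    (g : H) * y ^ b - γ⁻¹ ^ b • (y ^ b * g) ∈ filt k H b := by
  obtain ⟨c, hcm, hceq⟩ : ∃ c ∈ groupSpan k H, (g : H) * y = γ⁻¹ • (y * g) - c := by
    refine ⟨γ⁻¹ • (g * (((g⁻¹ : GroupLike k H) : H) * y * g - γ • y)), ?_, ?_⟩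
    · exact Subalgebra.smul_mem _ (mul_mem (coe_mem_groupSpan g) hc) _
    · rw [mul_sub, ← mul_assoc, ← mul_assoc, coe_mul_inv, one_mul, mul_smul_comm, smul_sub,
        smul_smul, inv_mul_cancel₀ hγ, one_smul]
      abel
  induction b with
  | zero => simp
  | succ b ih =>
    have h1 : (g : H) * y ^ (b + 1) - γ⁻¹ ^ (b + 1) • (y ^ (b + 1) * g) =
        γ⁻¹ • (y * ((g : H) * y ^ b - γ⁻¹ ^ b • (y ^ b * g))) - c * y ^ b := by
      rw [pow_succ' y, ← mul_assoc, hceq, pow_succ' γ⁻¹]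
      simp only [sub_mul, smul_mul_assoc, mul_sub, mul_smul_comm, smul_sub, smul_smul, mul_assoc]
      abel
    rw [h1]
    exact sub_mem (Submodule.smul_mem _ _ (hy.mul_mem_filt ih))
      (groupSpan_mul_mem_filt hcm (lead_pow hy b).mem_filt)

/-- The Leibniz rule for `y * y ^ (b + 1)` yields `g * y ^ (b + 1)` plus `y` times the previous
derivative. Moving `g` to the right adds the next term `γ⁻¹ ^ (b + 1)` of the geometric sum. -/
theorem sliceGood_of_commutator {g : GroupLike k H} {y : H} (hy : IsPrimitiveAt g y) {γ : k}
    (hγ : γ ≠ 0) (hc : ((g⁻¹ : GroupLike k H) : H) * y * g - γ • y ∈ groupSpan k H)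
    (hne : ∀ b : ℕ, ∑ i ∈ Finset.range (b + 1), γ⁻¹ ^ i ≠ 0) (b : ℕ) : SliceGood g y b := by
  intro f hf hfy
  refine ⟨_, hne b, ?_⟩
  clear hne
  induction b with
  | zero => simp [hy.slice, hf 1 (one_mem _), hfy]
  | succ b ih =>
    have h1 := (lead_pow hy (b + 1)).slice_mul_sub hy f
    rw [hfy, one_smul] at h1
    have h2 := hy.mul_mem_filt ih
    have h3 := coe_mul_pow_sub hy hγ hc (b + 1)
    convert add_mem (add_mem h1 h2) h3 using 1
    rw [← pow_succ', Finset.sum_range_succ _ (b + 1), mul_sub, mul_smul_comm, ← mul_assoc y,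
      ← pow_succ', add_smul]
    abel

variable {I : Type*}

/-- The ordered monomial `⋯ y_{j₂} ^ a_{j₂} * y_{j₁} ^ a_{j₁}` for a list `[j₁, j₂, …]`. -/
def mon (y : I → H) : List I → (I → ℕ) → H
  | [], _ => 1
  | j :: l, a => mon y l a * y j ^ a j

theorem mon_congr (y : I → H) {l : List I} {a b : I → ℕ} (h : ∀ j ∈ l, a j = b j) :
    mon y l a = mon y l b := by
  induction l with
  | nil => rfl
  | cons j l ih =>
    simp only [mon]
    rw [ih fun i hi => h i (List.mem_cons_of_mem _ hi), h j List.mem_cons_self]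

variable {y : I → H} {g : I → GroupLike k H}

theorem lead.mon_mul (hy : ∀ i, IsPrimitiveAt (g i) (y i)) (l : List I) (a : I → ℕ) {e : ℕ} {u : H}
    (hu : lead k e u) : lead k (e + (l.map a).sum) (mon y l a * u) := by
  induction l generalizing u e with
  | nil => simpa [mon]
  | cons j l ih =>
    have := ih (hu.pow_mul (hy j) (a j))
    simpa [mon, mul_assoc, add_assoc] using this

theorem lead_mon (hy : ∀ i, IsPrimitiveAt (g i) (y i)) (l : List I) (a : I → ℕ) :
    lead k (l.map a).sum (mon y l a) := by
  simpa using lead_one.mon_mul hy l a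

theorem mon_mul_mem_filt (hy : ∀ i, IsPrimitiveAt (g i) (y i)) (l : List I) (a : I → ℕ) {d : ℕ}
    {u : H} (hu : u ∈ filt k H d) : mon y l a * u ∈ filt k H (d + (l.map a).sum) := by
  induction l generalizing u d with
  | nil => simpa [mon]
  | cons j l ih =>
    have := ih ((hy j).pow_mul_mem_filt hu (a j))
    simpa [mon, mul_assoc, add_assoc] using this

theorem lead.slice_mon_mul_sub (hy : ∀ i, IsPrimitiveAt (g i) (y i)) (l : List I) (a : I → ℕ)
    {e : ℕ} {u : H} (hu : lead k e u) {f : Module.Dual k H} (hf : ∀ i ∈ l, f (y i) = 0) (m : ℕ)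
    (hm : e + (l.map a).sum ≤ m + 1) :
    slice f (mon y l a * u) - mon y l a * slice f u ∈ filt k H m := by
  induction l generalizing u e with
  | nil => simp [mon]
  | cons j l ih =>
    simp only [List.map_cons, List.sum_cons] at hm
    have h1 := ih (hu.pow_mul (hy j) (a j)) (fun i hi => hf i (List.mem_cons_of_mem _ hi))
      (by omega)
    have h2 : mon y l a * (slice f (y j ^ a j * u) - y j ^ a j * slice f u) ∈ filt k H m := by
      -- Guards the truncated subtraction below: if `m` is smaller than the degree of the left
      -- block, `hm` forces `a j = 0`.
      rcases Nat.lt_or_ge m (l.map a).sum with h | h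
      · have : a j = 0 := by omega
        simp [this]
      · have := mon_mul_mem_filt hy l a (hu.slice_pow_mul_sub (hy j) (hf j List.mem_cons_self)
          (a j) (m - (l.map a).sum) (by omega))
        rwa [Nat.sub_add_cancel h] at this
    convert add_mem h1 h2 using 1
    simp only [mon, mul_assoc, mul_sub]
    abel

/-- The factors from `l` behave as constants for `f`. Because the power of `y j` stands rightmost,
`g j` appears at the right end, the same for all monomials, and can later be cancelled. -/
theorem slice_mon_cons (hy : ∀ i, IsPrimitiveAt (g i) (y i)) {j : I} {l : List I}
    {a : I → ℕ} {d : ℕ} (hd : ((j :: l).map a).sum = d + 1)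
    (hgood : ∀ b < a j, SliceGood (g j) (y j) b)
    {f : Module.Dual k H} (hfC : annC0 f) (hfj : f (y j) = 1) (hf : ∀ i ∈ l, f (y i) = 0) :
    ∃ c : k, (c = 0 ↔ a j = 0) ∧
      slice f (mon y (j :: l) a) - c • (mon y l a * y j ^ (a j - 1) * g j) ∈ filt k H d := by
  simp only [List.map_cons, List.sum_cons] at hd
  have h1 := (lead_pow (hy j) (a j)).slice_mon_mul_sub hy l a hf d (by omega)
  obtain h0 | ⟨b, hb⟩ : a j = 0 ∨ ∃ b, a j = b + 1 := by
    cases a j <;> simp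
  · refine ⟨0, by simp [h0], ?_⟩
    simpa [mon, h0, slice_one, hfC 1 (one_mem _)] using h1
  · obtain ⟨c, hc, hmem⟩ := hgood b (by omega) f hfC hfj
    refine ⟨c, by simp [hc, hb], ?_⟩
    have h2 := mon_mul_mem_filt hy l a hmem
    rw [show b + (l.map a).sum = d by omega] at h2
    convert add_mem h1 h2 using 1
    simp only [mon, hb, mul_assoc, mul_sub, mul_smul_comm, Nat.add_sub_cancel]
    abel

/-- Degree `d` monomials lie in `filt (d + 1)`, so this is independence of leading terms. The proof
is a double induction: differentiating in the head variable lowers `d`, and monomials free of that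
variable are handled by the shorter list. -/
theorem mon_coeff_eq_zero (hy : ∀ i, IsPrimitiveAt (g i) (y i))
    (hdual : ∀ j, ∃ f : Module.Dual k H, annC0 f ∧ f (y j) = 1 ∧ ∀ i, i ≠ j → f (y i) = 0)
    {ι : Type*} (l : List I) (hl : l.Nodup) (d : ℕ) (A : Finset ι) (φ : ι → I → ℕ) (c : ι → k)
    (hdeg : ∀ i ∈ A, (l.map (φ i)).sum = d)
    (hinj : ∀ i ∈ A, ∀ i' ∈ A, (∀ j ∈ l, φ i j = φ i' j) → i = i')
    (hgood : ∀ i ∈ A, ∀ j ∈ l, ∀ b < φ i j, SliceGood (g j) (y j) b)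
    (hsum : ∑ i ∈ A, c i • mon y l (φ i) ∈ filt k H d) : ∀ i ∈ A, c i = 0 := by
  classical
  induction l generalizing d A φ c with
  | nil =>
    intro i hi
    obtain rfl : d = 0 := by simpa using (hdeg i hi).symm
    have hA : A = {i} := by
      ext i'
      simp only [Finset.mem_singleton]
      exact ⟨fun h => hinj i' h i hi (by simp), fun h => h ▸ hi⟩
    have : (1 : H) ≠ 0 := (IsGroupLikeElem.one (R := k)).ne_zero
    simpa [hA, mon, filt_zero, this] using hsum
  | cons j l ihl =>
    obtain ⟨hjl, hl'⟩ := List.nodup_cons.1 hl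
    have rest : ∀ (d : ℕ) (A : Finset ι) (φ : ι → I → ℕ) (c : ι → k),
        (∀ i ∈ A, ((j :: l).map (φ i)).sum = d) →
        (∀ i ∈ A, ∀ i' ∈ A, (∀ j' ∈ j :: l, φ i j' = φ i' j') → i = i') →
        (∀ i ∈ A, ∀ j' ∈ j :: l, ∀ b < φ i j', SliceGood (g j') (y j') b) →
        (∑ i ∈ A, c i • mon y (j :: l) (φ i) ∈ filt k H d) →
        (∀ i ∈ A, φ i j = 0) → ∀ i ∈ A, c i = 0 := by
      intro d A φ c hdeg hinj hgood hsum h0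
      refine ihl hl' d A φ c (fun i hi => ?_) (fun i hi i' hi' h => ?_)
        (fun i hi j' hj' => hgood i hi j' (List.mem_cons_of_mem _ hj')) ?_
      · simpa [h0 i hi] using hdeg i hi
      · refine hinj i hi i' hi' fun j' hj' => ?_
        rcases List.mem_cons.1 hj' with rfl | hj'
        · rw [h0 i hi, h0 i' hi']
        · exact h j' hj'
      · convert hsum using 1
        exact Finset.sum_congr rfl fun i hi => by simp [mon, h0 i hi]
    induction d generalizing A φ c with
    | zero =>
      refine rest 0 A φ c hdeg hinj hgood hsum fun i hi => ?_
      have := hdeg i hi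
      simp only [List.map_cons, List.sum_cons] at this
      omega
    | succ d ihd =>
      obtain ⟨f, hfC, hfj, hf⟩ := hdual j
      have hfl : ∀ i ∈ l, f (y i) = 0 := fun i hi => hf i (by rintro rfl; exact hjl hi)
      have hex : ∀ i, ∃ c' : k, i ∈ A → (c' = 0 ↔ φ i j = 0) ∧
          slice f (mon y (j :: l) (φ i)) -
            c' • (mon y l (φ i) * y j ^ (φ i j - 1) * g j) ∈ filt k H d := by
        intro i
        by_cases hi : i ∈ A
        · obtain ⟨c', h⟩ := slice_mon_cons hy (hdeg i hi) (hgood i hi j List.mem_cons_self)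
            hfC hfj hfl
          exact ⟨c', fun _ => h⟩
        · exact ⟨0, fun h => absurd h hi⟩
      choose c' hc' using hex
      -- Differentiate the relation along `y j` and cancel the common right factor `g j`.
      have h1 : ∑ i ∈ A, (c i * c' i) • (mon y l (φ i) * y j ^ (φ i j - 1)) ∈ filt k H d := by
        have h2 := mem_filt_succ.1 hsum f hfC
        have h3 : ∑ i ∈ A, c i • (slice f (mon y (j :: l) (φ i)) -
            c' i • (mon y l (φ i) * y j ^ (φ i j - 1) * g j)) ∈ filt k H d :=
          Submodule.sum_mem _ fun i hi => Submodule.smul_mem _ _ (hc' i hi).2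
        have h4 := mul_coe_mem_filt (g j)⁻¹ (sub_mem h2 h3)
        convert h4 using 1
        simp only [map_sum, map_smul, smul_sub, Finset.sum_sub_distrib, sub_sub_cancel,
          Finset.sum_mul, smul_mul_assoc, mul_assoc, coe_mul_inv, mul_one, smul_smul]
      set A₁ := A.filter fun i => φ i j ≠ 0 with hA₁
      have hupd : ∀ i, ∀ j' ∈ l, Function.update (φ i) j (φ i j - 1) j' = φ i j' := by
        intro i j' hj'
        rw [Function.update_of_ne]
        rintro rfl
        exact hjl hj'
      have hmap : ∀ i, l.map (Function.update (φ i) j (φ i j - 1)) = l.map (φ i) := fun i =>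
        List.map_congr_left (hupd i)
      -- Only positive exponents of `j` are kept: there `φ i j - 1` is genuine, so distinct
      -- monomials stay distinct.
      have h5 : ∀ i ∈ A₁, c i * c' i = 0 := by
        refine ihd A₁ (fun i => Function.update (φ i) j (φ i j - 1)) (fun i => c i * c' i)
          (fun i hi => ?_) (fun i hi i' hi' h => ?_) (fun i hi j' hj' b hb => ?_) ?_
        · obtain ⟨hi, h0⟩ := Finset.mem_filter.1 hi
          have := hdeg i hi
          simp only [List.map_cons, List.sum_cons, hmap, Function.update_self] at this ⊢
          omega
        · obtain ⟨hi, h0⟩ := Finset.mem_filter.1 hi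
          obtain ⟨hi', h0'⟩ := Finset.mem_filter.1 hi'
          refine hinj i hi i' hi' fun j' hj' => ?_
          have := h j' hj'
          rcases List.mem_cons.1 hj' with rfl | hj'
          · simp only [Function.update_self] at this
            omega
          · rwa [hupd i j' hj', hupd i' j' hj'] at this
        · have hi := (Finset.mem_filter.1 hi).1
          refine hgood i hi j' hj' b (hb.trans_le ?_)
          by_cases hjj : j' = j
          · subst hjj
            simp
          · rw [Function.update_of_ne hjj]
        · convert h1 using 1
          rw [hA₁, Finset.sum_filter]
          refine Finset.sum_congr rfl fun i hi => ?_
          split_ifs with h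
          · rw [mon, mon_congr y (hupd i), Function.update_self]
          · rw [((hc' i hi).1).2 (not_not.1 h)]
            simp
      have h6 : ∀ i ∈ A, φ i j ≠ 0 → c i = 0 := fun i hi h =>
        (mul_eq_zero.1 (h5 i (Finset.mem_filter.2 ⟨hi, h⟩))).resolve_right
          fun h' => h ((hc' i hi).1.1 h')
      set A₀ := A.filter fun i => φ i j = 0 with hA₀
      have hsub : ∀ i ∈ A₀, i ∈ A := fun i hi => (Finset.mem_filter.1 hi).1
      have h7 : ∀ i ∈ A₀, c i = 0 := by
        refine rest (d + 1) A₀ φ c (fun i hi => hdeg i (hsub i hi))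
          (fun i hi i' hi' => hinj i (hsub i hi) i' (hsub i' hi'))
          (fun i hi => hgood i (hsub i hi)) ?_ (fun i hi => (Finset.mem_filter.1 hi).2)
        convert hsum using 1
        rw [hA₀, Finset.sum_filter]
        refine Finset.sum_congr rfl fun i hi => ?_
        split_ifs with h
        · rfl
        · simp [h6 i hi h]
      intro i hi
      by_cases h : φ i j = 0
      · exact h7 i (Finset.mem_filter.2 ⟨hi, h⟩)
      · exact h6 i hi h

/-- The ordered monomials in skew primitive elements that are independent modulo `kG(H)`, multiplied
by group-like elements, are linearly independent. -/
theorem linearIndependent_mon_mul_coe (hy : ∀ i, IsPrimitiveAt (g i) (y i))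
    (hind : LinearIndependent k fun i => (Subalgebra.toSubmodule (groupSpan k H)).mkQ (y i))
    {l : List I} (hl : l.Nodup) (hmem : ∀ i, i ∈ l) {S : Set (I → ℕ)}
    (hS : ∀ a ∈ S, ∀ j, ∀ b < a j, SliceGood (g j) (y j) b) :
    LinearIndependent k fun p : S × GroupLike k H => mon y l p.1 * (p.2 : H) := by
  classical
  have hdual : ∀ j, ∃ f : Module.Dual k H, annC0 f ∧ f (y j) = 1 ∧
      ∀ i, i ≠ j → f (y i) = 0 := by
    intro j
    obtain ⟨f, h1, h2⟩ := hind.exists_dual_eq_one j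
    refine ⟨f ∘ₗ Submodule.mkQ _, fun u hu => ?_, h1, h2⟩
    rw [LinearMap.comp_apply, Submodule.mkQ_apply, (Submodule.Quotient.mk_eq_zero _).2 hu, map_zero]
  rw [linearIndependent_iff']
  intro s c hsum
  by_contra! hne
  obtain ⟨p₁, hp₁, hc₁⟩ := hne
  set s' := s.filter fun p => c p ≠ 0 with hs'
  obtain ⟨p₀, hp₀, hmax⟩ := Finset.exists_max_image s' (fun p => (l.map p.1.1).sum)
    ⟨p₁, Finset.mem_filter.2 ⟨hp₁, hc₁⟩⟩
  set d := (l.map p₀.1.1).sum with hd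
  set t := s'.filter fun p => (l.map p.1.1).sum = d with ht
  -- The terms of maximal degree `d` equal minus the remaining ones, which have degree below `d` and
  -- hence lie in `filt d`.
  have h1 : ∑ p ∈ t, c p • (mon y l p.1 * (p.2 : H)) ∈ filt k H d := by
    have h2 : ∑ p ∈ s', c p • (mon y l p.1 * (p.2 : H)) = 0 := by
      rw [← hsum, hs', Finset.sum_filter]
      refine Finset.sum_congr rfl fun p _ => ?_
      split_ifs with h
      · rfl
      · simp [not_not.1 h]
    rw [← Finset.sum_filter_add_sum_filter_not s' (fun p => (l.map p.1.1).sum = d)] at h2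
    rw [eq_neg_of_add_eq_zero_left h2]
    refine neg_mem (Submodule.sum_mem _ fun p hp => Submodule.smul_mem _ _ ?_)
    obtain ⟨hp, hpd⟩ := Finset.mem_filter.1 hp
    have hlt := lt_of_le_of_ne (hmax p hp) hpd
    exact filt_mono hlt (mul_coe_mem_filt p.2 (lead_mon hy l p.1).mem_filt)
  obtain ⟨φ, hφ1, hφ⟩ := (linearIndep_groupLikeVal (R := k) (A := H)).exists_dual_eq_one p₀.2
  -- Modulo `filt d`, slicing by `φ` multiplies a leading term ending in `h` by `φ h`, so only terms
  -- ending in `p₀.2` survive.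
  have h3 : ∑ p ∈ t, (c p * φ p.2) • (mon y l p.1 * (p.2 : H)) ∈ filt k H d := by
    have h4 := slice_mem_filt φ h1
    have h5 : ∑ p ∈ t, c p • (slice φ (mon y l p.1 * (p.2 : H)) -
        φ p.2 • (mon y l p.1 * (p.2 : H))) ∈ filt k H d := by
      refine Submodule.sum_mem _ fun p hp => Submodule.smul_mem _ _ ?_
      have := (lead_mon hy l p.1).slice_mul_coe_sub φ p.2
      rwa [(Finset.mem_filter.1 hp).2] at this
    convert sub_mem h4 h5 using 1
    simp only [map_sum, map_smul, smul_sub, Finset.sum_sub_distrib, sub_sub_cancel, smul_smul]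
  set t₀ := t.filter fun p => p.2 = p₀.2 with ht₀
  have h6 : ∑ p ∈ t₀, c p • mon y l p.1 ∈ filt k H d := by
    convert mul_coe_mem_filt p₀.2⁻¹ h3 using 1
    rw [Finset.sum_mul, ht₀, Finset.sum_filter]
    refine Finset.sum_congr rfl fun p _ => ?_
    split_ifs with h
    · rw [h, hφ1, mul_one, smul_mul_assoc, mul_assoc, coe_mul_inv, mul_one]
    · rw [hφ _ h, mul_zero, zero_smul, zero_mul]
  have h7 := mon_coeff_eq_zero hy hdual l hl d t₀ (fun p => p.1.1) c
    (fun p hp => (Finset.mem_filter.1 (Finset.mem_filter.1 hp).1).2)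
    (fun p hp p' hp' h => Prod.ext (Subtype.ext (funext fun j => h j (hmem j)))
      ((Finset.mem_filter.1 hp).2.trans (Finset.mem_filter.1 hp').2.symm))
    (fun p _ j _ => hS p.1 p.1.2 j) h6
  exact (Finset.mem_filter.1 hp₀).2
    (h7 p₀ (Finset.mem_filter.2 ⟨Finset.mem_filter.2 ⟨hp₀, rfl⟩, rfl⟩))

end Monomials

/-! ### The `q`-binomial theorem at roots of unity -/

section QBinomial

variable {k : Type*} [Field k]

/-- The Gaussian binomial coefficients evaluated at `q`. -/
def gaussBinom (q : k) : ℕ → ℕ → k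
  | _, 0 => 1
  | 0, _ + 1 => 0
  | n + 1, i + 1 => gaussBinom q n i + q ^ (i + 1) * gaussBinom q n (i + 1)

theorem gaussBinom_zero_right (q : k) (n : ℕ) : gaussBinom q n 0 = 1 := by
  cases n <;> rfl

theorem gaussBinom_succ_succ (q : k) (n i : ℕ) : gaussBinom q (n + 1) (i + 1) =
    gaussBinom q n i + q ^ (i + 1) * gaussBinom q n (i + 1) := rfl

theorem gaussBinom_eq_zero_of_lt (q : k) {n i : ℕ} (h : n < i) : gaussBinom q n i = 0 := by
  induction n generalizing i with
  | zero => obtain ⟨i, rfl⟩ := Nat.exists_eq_succ_of_ne_zero h.ne'; rfl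
  | succ n ih =>
    obtain ⟨i, rfl⟩ := Nat.exists_eq_succ_of_ne_zero (by omega : i ≠ 0)
    rw [Nat.succ_eq_add_one, gaussBinom_succ_succ, ih (by omega), ih (by omega), mul_zero, add_zero]

theorem gaussBinom_self (q : k) (n : ℕ) : gaussBinom q n n = 1 := by
  induction n with
  | zero => rfl
  | succ n ih =>
    rw [gaussBinom_succ_succ, ih, gaussBinom_eq_zero_of_lt q n.lt_succ_self, mul_zero, add_zero]

/-- The division-free absorption identity; at a primitive root of order `n + 1` the right side
vanishes, which kills the intermediate coefficients. -/
theorem gaussBinom_succ_mul (q : k) (n i : ℕ) : gaussBinom q (n + 1) (i + 1) * (q ^ (i + 1) - 1) =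
    (q ^ (n + 1) - 1) * gaussBinom q n i := by
  induction n generalizing i with
  | zero =>
    cases i with
    | zero => simp [gaussBinom]
    | succ i => simp [gaussBinom]
  | succ n ih =>
    have h1 := ih i
    rw [gaussBinom_succ_succ]
    cases i with
    | zero =>
      simp only [gaussBinom_zero_right] at h1 ⊢
      linear_combination q * h1
    | succ i =>
      have h2 := ih i
      have h3 := gaussBinom_succ_succ q n i
      linear_combination q ^ (i + 2) * h1 + q * h2 - q * (q ^ (n + 1) - 1) * h3

theorem add_pow_of_mul_eq_smul {A : Type*} [Ring A] [Algebra k A] {q : k} {x y : A}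
    (h : x * y = q • (y * x)) (n : ℕ) :
    (x + y) ^ n = ∑ i ∈ Finset.range (n + 1), gaussBinom q n i • (y ^ i * x ^ (n - i)) := by
  have hxy : ∀ i : ℕ, x * y ^ i = q ^ i • (y ^ i * x) := by
    intro i
    induction i with
    | zero => simp
    | succ i ih =>
      rw [pow_succ y, ← mul_assoc, ih, smul_mul_assoc, mul_assoc, h, mul_smul_comm, smul_smul,
        pow_succ, mul_assoc]
  induction n with
  | zero => simp [gaussBinom]
  | succ n ih =>
    have h1 : ∑ i ∈ Finset.range (n + 1), (gaussBinom q n i * q ^ i) • (y ^ i * x ^ (n + 1 - i)) =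
        ∑ i ∈ Finset.range (n + 1),
          (gaussBinom q n (i + 1) * q ^ (i + 1)) • (y ^ (i + 1) * x ^ (n + 1 - (i + 1))) +
        x ^ (n + 1) := by
      have h2 := Finset.sum_range_succ
        (fun i => (gaussBinom q n i * q ^ i) • (y ^ i * x ^ (n + 1 - i))) (n + 1)
      rw [Finset.sum_range_succ', gaussBinom_eq_zero_of_lt q n.lt_succ_self, zero_mul, zero_smul,
        add_zero] at h2
      rw [← h2]
      simp [gaussBinom_zero_right]
    have h3 : x * ∑ i ∈ Finset.range (n + 1), gaussBinom q n i • (y ^ i * x ^ (n - i)) =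
        ∑ i ∈ Finset.range (n + 1),
          (gaussBinom q n i * q ^ i) • (y ^ i * x ^ (n + 1 - i)) := by
      rw [Finset.mul_sum]
      refine Finset.sum_congr rfl fun i hi => ?_
      have hi' : n + 1 - i = n - i + 1 := by
        have := Finset.mem_range.1 hi
        omega
      rw [mul_smul_comm, ← mul_assoc, hxy, smul_mul_assoc, smul_smul, hi', pow_succ', mul_assoc]
    rw [pow_succ', ih, add_mul, h3, h1, Finset.sum_range_succ' _ (n + 1), Finset.mul_sum,
      add_right_comm, ← Finset.sum_add_distrib]
    simp only [gaussBinom_zero_right, pow_zero, one_mul, one_smul, Nat.sub_zero]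
    congr 1
    refine Finset.sum_congr rfl fun i _ => ?_
    rw [gaussBinom_succ_succ, add_smul, mul_smul_comm, ← mul_assoc, ← pow_succ', Nat.add_sub_add_right,
      mul_comm (q ^ (i + 1)), add_comm]

theorem add_pow_of_isPrimitiveRoot {A : Type*} [Ring A] [Algebra k A] {q : k} {x y : A}
    (h : x * y = q • (y * x)) {N : ℕ} (hN : 0 < N) (hq : IsPrimitiveRoot q N) :
    (x + y) ^ N = x ^ N + y ^ N := by
  obtain ⟨m, rfl⟩ := Nat.exists_eq_succ_of_ne_zero hN.ne'
  rw [Nat.succ_eq_add_one] at hq ⊢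
  rw [add_pow_of_mul_eq_smul h, Finset.sum_range_succ, Finset.sum_range_succ', gaussBinom_self,
    Finset.sum_eq_zero]
  · simp [gaussBinom_zero_right]
  · intro i hi
    have hi := Finset.mem_range.1 hi
    have h1 := gaussBinom_succ_mul q m i
    rw [hq.pow_eq_one, sub_self, zero_mul, mul_eq_zero, sub_eq_zero] at h1
    rw [h1.resolve_right (hq.pow_ne_one_of_pos_of_lt (by omega) (by omega)), zero_smul]

end QBinomial

/-! ### Commutators, conjugation and independence modulo `kG(H)` -/

section Commutators

variable {k : Type*} [Field k] {H : Type*} [Ring H] [HopfAlgebra k H]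

/-- The left coaction operator `(φ ⊗ id) ∘ Δ` of a functional `φ`. -/
noncomputable def leftSlice (φ : Module.Dual k H) : H →ₗ[k] H :=
  (TensorProduct.lid k H).toLinearMap ∘ₗ φ.rTensor H ∘ₗ Coalgebra.comul

theorem leftSlice_coe (φ : Module.Dual k H) (g : GroupLike k H) :
    leftSlice φ (g : H) = φ (g : H) • (g : H) := by
  simp [leftSlice]

theorem IsPrimitiveAt.leftSlice {g : GroupLike k H} {p : H} (hp : IsPrimitiveAt g p)
    (φ : Module.Dual k H) : leftSlice φ p = φ p • (1 : H) + φ (g : H) • p := by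
  rw [IsPrimitiveAt] at hp
  simp [SkewPrim.leftSlice, hp]

theorem leftSlice_mem_groupSpan (φ : Module.Dual k H) {u : H} (hu : u ∈ groupSpan k H) :
    leftSlice φ u ∈ groupSpan k H :=
  groupSpan_induction (p := fun u => leftSlice φ u ∈ groupSpan k H)
    (fun g => by
      rw [leftSlice_coe]
      exact Subalgebra.smul_mem _ (coe_mem_groupSpan g) _)
    (by simp) (fun x y hx hy => by simpa using add_mem hx hy)
    (fun c x hx => by simpa using Subalgebra.smul_mem _ hx c) hu

theorem leftSlice_of_dual {φ : Module.Dual k H} {g : GroupLike k H}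
    (hφ : ∀ h : GroupLike k H, h ≠ g → φ (h : H) = 0) {u : H} (hu : u ∈ groupSpan k H) :
    leftSlice φ u = φ u • (g : H) :=
  groupSpan_induction (p := fun u => leftSlice φ u = φ u • (g : H))
    (fun h => by
      rw [leftSlice_coe]
      by_cases hh : h = g
      · rw [hh]
      · rw [hφ h hh, zero_smul, zero_smul])
    (by simp) (fun x y hx hy => by simp [hx, hy, add_smul])
    (fun c x hx => by simp [hx, smul_smul]) hu

/-- Left slicing by `φ` dual to `g` gives `φ c • 1 + c` by skew primitivity and `φ c • g` by
membership in `C₀`. -/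
theorem IsPrimitiveAt.eq_smul_of_mem_groupSpan {g : GroupLike k H} {c : H} (hc : IsPrimitiveAt g c)
    (hmem : c ∈ groupSpan k H) : ∃ s : k, c = s • ((g : H) - 1) := by
  obtain ⟨φ, h1, h2⟩ := (linearIndep_groupLikeVal (R := k) (A := H)).exists_dual_eq_one g
  refine ⟨φ c, ?_⟩
  have h3 := hc.leftSlice φ
  rw [leftSlice_of_dual h2 hmem, h1, one_smul] at h3
  rw [smul_sub, h3]
  abel

/-- The conjugation `u ↦ g⁻¹ u g`. -/
noncomputable def conj (g : GroupLike k H) : Module.End k H :=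
  LinearMap.mulLeft k ((g⁻¹ : GroupLike k H) : H) ∘ₗ LinearMap.mulRight k (g : H)

theorem conj_apply (g : GroupLike k H) (u : H) :
    SkewPrim.conj g u = ((g⁻¹ : GroupLike k H) : H) * u * g := (mul_assoc _ _ _).symm

theorem coe_mul_conj (g : GroupLike k H) (u : H) : (g : H) * SkewPrim.conj g u = u * g := by
  rw [conj_apply, mul_assoc, ← mul_assoc, coe_mul_inv, one_mul]

theorem IsPrimitiveAt.add {g : GroupLike k H} {x y : H} (hx : IsPrimitiveAt g x)
    (hy : IsPrimitiveAt g y) : IsPrimitiveAt g (x + y) := by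
  rw [IsPrimitiveAt] at *
  rw [map_add, hx, hy, TensorProduct.add_tmul, TensorProduct.tmul_add]
  abel

theorem IsPrimitiveAt.smul {g : GroupLike k H} {x : H} (hx : IsPrimitiveAt g x) (c : k) :
    IsPrimitiveAt g (c • x) := by
  rw [IsPrimitiveAt] at *
  rw [map_smul, hx, smul_add, TensorProduct.smul_tmul', TensorProduct.tmul_smul]

theorem IsPrimitiveAt.sub {g : GroupLike k H} {x y : H} (hx : IsPrimitiveAt g x)
    (hy : IsPrimitiveAt g y) : IsPrimitiveAt g (x - y) := by
  simpa [sub_eq_add_neg] using hx.add (hy.smul (-1))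

theorem IsPrimitiveAt.conj {g : GroupLike k H} {y : H} (hy : IsPrimitiveAt g y) :
    IsPrimitiveAt g (conj g y) := by
  rw [IsPrimitiveAt] at *
  have h1 := (g⁻¹).isGroupLikeElem_val.comul_eq_tmul_self
  have h2 := g.isGroupLikeElem_val.comul_eq_tmul_self
  rw [conj_apply, Bialgebra.comul_mul, Bialgebra.comul_mul, hy, h1, h2]
  simp only [mul_add, add_mul, Algebra.TensorProduct.tmul_mul_tmul, mul_one, coe_inv_mul, one_mul]

theorem conj_mem_groupSpan (g : GroupLike k H) {u : H} (hu : u ∈ groupSpan k H) :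
    conj g u ∈ groupSpan k H := by
  rw [conj_apply]
  exact mul_mem (mul_mem (coe_mem_groupSpan _) hu) (coe_mem_groupSpan _)

theorem mem_groupSpan_of_conj {g : GroupLike k H} {u : H} (hu : conj g u ∈ groupSpan k H) :
    u ∈ groupSpan k H := by
  have h : u = g * conj g u * ((g⁻¹ : GroupLike k H) : H) := by
    rw [coe_mul_conj, mul_assoc, coe_mul_inv, mul_one]
  rw [h]
  exact mul_mem (mul_mem (coe_mem_groupSpan _) hu) (coe_mem_groupSpan _)

/-- A skew primitive element whose commutator is a nontrivial root of unity can be corrected by an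
element of `kG(H)` so that one of its powers is skew primitive. -/
theorem mem_sqrtWeights {g : GroupLike k H} {y : H} (hy : IsPrimitiveAt g y)
    (hyC : y ∉ groupSpan k H) {γ : k} (hc : conj g y - γ • y ∈ groupSpan k H) (hγ : γ ≠ 1)
    {n : ℕ} (hn : 0 < n) (hγn : γ ^ n = 1) : g ∈ sqrtWeights k H := by
  obtain ⟨s, hs⟩ := (hy.conj.sub (hy.smul γ)).eq_smul_of_mem_groupSpan hc
  set c := conj g y - γ • y with hcdef
  have hcp : IsPrimitiveAt g c := hy.conj.sub (hy.smul γ)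
  have hcc : conj g c = c := by
    rw [hs, map_smul, conj_apply, mul_sub, sub_mul, coe_inv_mul, one_mul, mul_one, coe_inv_mul]
  have hγ1 : γ - 1 ≠ 0 := sub_ne_zero.2 hγ
  -- Since `c` is a multiple of `g - 1`, conjugation fixes it; this correction, possible as `γ ≠ 1`,
  -- makes `z` an exact eigenvector for `γ`.
  set z := y + (γ - 1)⁻¹ • c with hz
  have hzp : IsPrimitiveAt g z := hy.add (hcp.smul _)
  have hzC : z ∉ groupSpan k H := fun h => hyC (by
    have := sub_mem h ((groupSpan k H).smul_mem hc (γ - 1)⁻¹)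
    rwa [hz, add_sub_cancel_right] at this)
  have hzc : conj g z = γ • z := by
    have h1 : conj g y = c + γ • y := by rw [hcdef]; abel
    have h2 : (1 : k) + (γ - 1)⁻¹ = γ * (γ - 1)⁻¹ := by
      field_simp
      ring
    rw [hz, map_add, map_smul, hcc, h1, smul_add, smul_smul, ← h2, add_smul, one_smul]
    abel
  have hord : 0 < orderOf γ := orderOf_pos_iff.2 (isOfFinOrder_iff_pow_eq_one.2 ⟨n, hn, hγn⟩)
  have hord1 : orderOf γ ≠ 1 := fun h => hγ (orderOf_eq_one_iff.1 h)
  refine ⟨z, hzp, hzC, orderOf γ, by omega, g ^ orderOf γ, ?_⟩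
  -- The two summands of `Δ z` commute up to `γ`, so at the order of `γ` the mixed terms of the
  -- power disappear.
  have hcomm : (z ⊗ₜ[k] (1 : H)) * ((g : H) ⊗ₜ[k] z) =
      γ • (((g : H) ⊗ₜ[k] z) * (z ⊗ₜ[k] (1 : H))) := by
    rw [Algebra.TensorProduct.tmul_mul_tmul, Algebra.TensorProduct.tmul_mul_tmul, one_mul, mul_one,
      ← coe_mul_conj, hzc, mul_smul_comm, TensorProduct.smul_tmul']
  rw [IsPrimitiveAt] at hzp ⊢
  rw [Bialgebra.comul_pow, hzp, add_pow_of_isPrimitiveRoot hcomm hord (IsPrimitiveRoot.orderOf γ),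
    Algebra.TensorProduct.tmul_pow, Algebra.TensorProduct.tmul_pow, one_pow, GroupLike.val_pow]

/-- The endomorphism of `H / kG(H)` induced by conjugation. -/
noncomputable def conjQ (g : GroupLike k H) :
    Module.End k (H ⧸ Subalgebra.toSubmodule (groupSpan k H)) :=
  Submodule.mapQ _ _ (conj g) fun _ hu => conj_mem_groupSpan g hu

theorem conjQ_mkQ (g : GroupLike k H) (u : H) :
    conjQ g ((Subalgebra.toSubmodule (groupSpan k H)).mkQ u) =
      (Subalgebra.toSubmodule (groupSpan k H)).mkQ (conj g u) := rfl

theorem mkQ_groupSpan_eq_zero {u : H} :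
    (Subalgebra.toSubmodule (groupSpan k H)).mkQ u = 0 ↔ u ∈ groupSpan k H :=
  Submodule.Quotient.mk_eq_zero _

theorem conjQ_pow_mkQ (g : GroupLike k H) (n : ℕ) (u : H) :
    (conjQ g ^ n) ((Subalgebra.toSubmodule (groupSpan k H)).mkQ u) =
      (Subalgebra.toSubmodule (groupSpan k H)).mkQ ((conj g ^ n) u) := by
  induction n with
  | zero => rfl
  | succ n ih => rw [pow_succ', pow_succ', Module.End.mul_apply, ih, conjQ_mkQ, Module.End.mul_apply]

theorem IsPrimitiveAt.conj_pow {g : GroupLike k H} {y : H} (hy : IsPrimitiveAt g y) (n : ℕ) :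
    IsPrimitiveAt g ((SkewPrim.conj g ^ n) y) := by
  induction n with
  | zero => simpa
  | succ n ih =>
    rw [pow_succ', Module.End.mul_apply]
    exact ih.conj

theorem IsPrimitiveAt.aeval_conj {g : GroupLike k H} {y : H} (hy : IsPrimitiveAt g y)
    (p : Polynomial k) : IsPrimitiveAt g (Polynomial.aeval (SkewPrim.conj g) p y) := by
  induction p using Polynomial.induction_on' with
  | add p q hp hq =>
    rw [map_add, LinearMap.add_apply]
    exact hp.add hq
  | monomial n a =>
    rw [Polynomial.aeval_monomial, ← Algebra.smul_def, LinearMap.smul_apply]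
    exact (hy.conj_pow n).smul a

theorem aeval_conjQ_mkQ (g : GroupLike k H) (p : Polynomial k) (u : H) :
    Polynomial.aeval (conjQ g) p ((Subalgebra.toSubmodule (groupSpan k H)).mkQ u) =
      (Subalgebra.toSubmodule (groupSpan k H)).mkQ (Polynomial.aeval (conj g) p u) := by
  induction p using Polynomial.induction_on' with
  | add p q hp hq => rw [map_add, LinearMap.add_apply, hp, hq, map_add, LinearMap.add_apply, map_add]
  | monomial n a =>
    rw [Polynomial.aeval_monomial, ← Algebra.smul_def, LinearMap.smul_apply,
      Polynomial.aeval_monomial, ← Algebra.smul_def, LinearMap.smul_apply, conjQ_pow_mkQ, map_smul]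

theorem exists_commutator_or_linearIndependent [IsAlgClosed k] {g : GroupLike k H}
    (hg : g ∈ weights k H) :
    (∃ γ : kˣ, (g, γ) ∈ weightCommutators k H) ∨
      ∃ y : H, IsPrimitiveAt g y ∧ LinearIndependent k fun n : ℕ =>
        (Subalgebra.toSubmodule (groupSpan k H)).mkQ ((conj g ^ n) y) := by
  obtain ⟨y, hy, hyC⟩ := hg
  by_cases hind : LinearIndependent k fun n : ℕ =>
        (Subalgebra.toSubmodule (groupSpan k H)).mkQ ((conj g ^ n) y)
  · exact Or.inr ⟨y, hy, hind⟩
  left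
  simp only [← conjQ_pow_mkQ] at hind
  rw [Polynomial.linearIndependent_powers_iff_aeval] at hind
  push Not at hind
  obtain ⟨p, hp, hp0⟩ := hind
  -- Split off a root, `p = (X - c) q`. If `q` still annihilates the class of `y`, recurse;
  -- otherwise `q` applied to it is an eigenvector for `c`.
  induction hd : p.natDegree using Nat.strong_induction_on generalizing p with
  | _ d ih =>
  have hdeg : p.degree ≠ 0 := by
    intro h
    rw [Polynomial.eq_C_of_degree_eq_zero h, Polynomial.aeval_C, Module.algebraMap_end_apply,
      smul_eq_zero, mkQ_groupSpan_eq_zero] at hp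
    refine hp0 ?_
    rw [Polynomial.eq_C_of_degree_eq_zero h, hp.resolve_right hyC, Polynomial.C_0]
  obtain ⟨c, hc⟩ := IsAlgClosed.exists_root p hdeg
  obtain ⟨q, rfl⟩ := Polynomial.dvd_iff_isRoot.2 hc
  have hq0 : q ≠ 0 := right_ne_zero_of_mul hp0
  by_cases hq : Polynomial.aeval (conjQ g) q
      ((Subalgebra.toSubmodule (groupSpan k H)).mkQ y) = 0
  · refine ih q.natDegree ?_ q hq hq0 rfl
    rw [← hd, Polynomial.natDegree_mul (Polynomial.X_sub_C_ne_zero c) hq0,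
      Polynomial.natDegree_X_sub_C]
    omega
  · rw [map_mul, Module.End.mul_apply, aeval_conjQ_mkQ] at hp
    rw [aeval_conjQ_mkQ, mkQ_groupSpan_eq_zero] at hq
    set z := Polynomial.aeval (conj g) q y with hz
    have hzc : conj g z - c • z ∈ groupSpan k H := by
      rw [← mkQ_groupSpan_eq_zero, map_sub, map_smul, ← conjQ_mkQ]
      simpa using hp
    have hc0 : c ≠ 0 := by
      rintro rfl
      rw [zero_smul, sub_zero] at hzc
      exact hq (mem_groupSpan_of_conj hzc)
    exact ⟨Units.mk0 c hc0, z, hy.aeval_conj q, hq, by simpa [conj_apply] using hzc⟩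

/-- Skew primitive elements with distinct pairs (weight, commutator) are linearly independent modulo
the span of the group-like elements. -/
theorem linearIndependent_mkQ_of_injective {ι : Type*} {p : ι → GroupLike k H × kˣ}
    (hp : Function.Injective p) {y : ι → H} (hy : ∀ i, IsPrimitiveAt (p i).1 (y i))
    (hyC : ∀ i, y i ∉ groupSpan k H)
    (hc : ∀ i, conj (p i).1 (y i) - ((p i).2 : k) • y i ∈ groupSpan k H) :
    LinearIndependent k fun i => (Subalgebra.toSubmodule (groupSpan k H)).mkQ (y i) := by
  classical
  rw [linearIndependent_iff']
  intro s c hsum i₀ hi₀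
  set g := (p i₀).1 with hg
  obtain ⟨φ, h1, h2⟩ := (linearIndep_groupLikeVal (R := k) (A := H)).exists_dual_eq_one g
  have hsum1 : ∑ i ∈ s, c i • y i ∈ groupSpan k H := by
    rw [← mkQ_groupSpan_eq_zero, map_sum]
    simpa using hsum
  -- Up to a scalar, the left slice by `φ` keeps `y i` if its weight is `g` and kills it otherwise.
  have hsum2 : ∑ i ∈ s with (p i).1 = g, c i • y i ∈ groupSpan k H := by
    have h3 := sub_mem (leftSlice_mem_groupSpan φ hsum1)
      (sum_mem fun i (_ : i ∈ s) => (groupSpan k H).smul_mem (one_mem _) (c i * φ (y i)))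
    convert h3 using 1
    rw [map_sum, ← Finset.sum_sub_distrib, Finset.sum_filter]
    refine Finset.sum_congr rfl fun i _ => ?_
    rw [map_smul, (hy i).leftSlice, smul_add, smul_smul, add_sub_cancel_left]
    split_ifs with h
    · rw [h, h1, one_smul]
    · rw [h2 _ h, zero_smul, smul_zero]
  have hev : LinearIndependent k fun i : {i // (p i).1 = g} =>
      (Subalgebra.toSubmodule (groupSpan k H)).mkQ (y i) := by
    refine (conjQ g).eigenvectors_linearIndependent' (fun i => ((p i.1).2 : k)) ?_ _ ?_
    · rintro ⟨i, hi⟩ ⟨j, hj⟩ hij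
      exact Subtype.ext (hp (Prod.ext (hi.trans hj.symm) (Units.ext hij)))
    · rintro ⟨i, hi⟩
      refine ⟨?_, fun h => hyC i (mkQ_groupSpan_eq_zero.1 h)⟩
      rw [Module.End.mem_eigenspace_iff, conjQ_mkQ, ← map_smul, ← sub_eq_zero, ← map_sub,
        mkQ_groupSpan_eq_zero]
      have := hc i
      rwa [hi] at this
  have h4 := linearIndependent_iff'.1 hev (s.subtype fun i => (p i).1 = g) (fun i => c i) ?_
    ⟨i₀, rfl⟩ (by simpa using hi₀)
  · exact h4
  · rw [← mkQ_groupSpan_eq_zero, map_sum] at hsum2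
    simp only [map_smul] at hsum2
    rwa [Finset.sum_subtype_eq_sum_filter (s := s) (p := fun i => (p i).1 = g)
      (fun i => c i • (Subalgebra.toSubmodule (groupSpan k H)).mkQ (y i))]

end Commutators

/-! ### Growth estimates -/

section Growth

open Filter Topology

variable {k : Type*} [Field k]

theorem le_gkDim_of_frequently {A : Type*} [Ring A] [Algebra k A] {U : Submodule k A} (hU : U.FG)
    {c : ℝ≥0∞}
    (h : ∃ᶠ n : ℕ in atTop, c ≤ ENNReal.ofReal
      (Real.logb n (Module.finrank k ↥(∑ i ∈ Finset.range (n + 1), U ^ i)))) : c ≤ gkDim k A :=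
  (le_limsup_of_frequently_le' h).trans (le_iSup₂_of_le U hU le_rfl)

theorem card_le_finrank_sum_pow {A : Type*} [Ring A] [Algebra k A] {U : Submodule k A} (hU : U.FG)
    {ι : Type*} [Fintype ι] {v : ι → A} (hv : LinearIndependent k v) {m : ℕ}
    (hm : ∀ i, v i ∈ U ^ m) :
    Fintype.card ι ≤ Module.finrank k ↥(∑ i ∈ Finset.range (m + 1), U ^ i) := by
  have hfg : (∑ i ∈ Finset.range (m + 1), U ^ i).FG := by
    induction Finset.range (m + 1) using Finset.induction_on with
    | empty => exact Submodule.fg_bot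
    | insert a s ha ih =>
      rw [Finset.sum_insert ha]
      exact (hU.pow a).sup ih
  have hle : U ^ m ≤ ∑ i ∈ Finset.range (m + 1), U ^ i :=
    Finset.single_le_sum (f := fun i => U ^ i) (fun _ _ => bot_le) (Finset.self_mem_range_succ m)
  have : Module.Finite k ↥(∑ i ∈ Finset.range (m + 1), U ^ i) := Module.Finite.iff_fg.2 hfg
  have hv' : LinearIndependent k
      fun i => (⟨v i, hle (hm i)⟩ : ↥(∑ i ∈ Finset.range (m + 1), U ^ i)) :=
    LinearIndependent.of_comp (Submodule.subtype _) hv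
  exact hv'.fintype_card_le_finrank

theorem pow_le_pow_of_one_mem {A : Type*} [Ring A] [Algebra k A] {U : Submodule k A}
    (h1 : (1 : A) ∈ U) {m n : ℕ} (h : m ≤ n) : U ^ m ≤ U ^ n :=
  pow_le_pow_right₀ (Submodule.one_le.2 h1) h

variable {H : Type*} [Ring H] [HopfAlgebra k H]

theorem mon_mem_pow {I : Type*} {y : I → H} {U : Submodule k H} {r : ℕ} (hy : ∀ i, y i ∈ U ^ r)
    (l : List I) (a : I → ℕ) : mon y l a ∈ U ^ (r * (l.map a).sum) := by
  induction l with
  | nil => simpa [mon] using Submodule.one_le.1 (le_refl (1 : Submodule k H))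
  | cons j l ih =>
    rw [List.map_cons, List.sum_cons, add_comm, mul_add, pow_add, pow_mul U r (a j)]
    exact Submodule.mul_mem_mul ih (Submodule.pow_mem_pow _ (hy j) _)

theorem sum_map_finRange_le {n m : ℕ} {a : Fin n → ℕ} (h : ∀ i, a i ≤ m) :
    ((List.finRange n).map a).sum ≤ n * m := by
  have := List.sum_le_card_nsmul ((List.finRange n).map a) m (by simpa using h)
  simpa using this

variable (k H) in
/-- The inclusion of the group-like elements into their span. -/
noncomputable def groupLikeToSpan : GroupLike k H →* groupSpan k H where
  toFun g := ⟨g, coe_mem_groupSpan g⟩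
  map_one' := rfl
  map_mul' _ _ := rfl

theorem span_range_groupLikeToSpan :
    Submodule.span k (Set.range (groupLikeToSpan k H)) = ⊤ := by
  rw [eq_top_iff]
  rintro ⟨x, hx⟩ -
  have hx' : x ∈ Submodule.map (groupSpan k H).val.toLinearMap
      (Submodule.span k (Set.range (groupLikeToSpan k H))) :=
    groupSpan_induction
      (p := fun u => u ∈ Submodule.map (groupSpan k H).val.toLinearMap
        (Submodule.span k (Set.range (groupLikeToSpan k H))))
      (fun g => ⟨groupLikeToSpan k H g, Submodule.subset_span ⟨g, rfl⟩, rfl⟩) (zero_mem _)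
      (fun _ _ => add_mem) (fun c _ => Submodule.smul_mem _ c) hx
  obtain ⟨z, hz, hzx⟩ := hx'
  have hzx' : z = ⟨x, hx⟩ := Subtype.ext hzx
  exact hzx' ▸ hz

open scoped Pointwise in
-- Bounds growth in `C₀` by growth of a finite set in the group; `1 ∈ S` makes the powers of `S`
-- increase.
theorem exists_finset_finrank_le [DecidableEq (GroupLike k H)] {V : Submodule k (groupSpan k H)}
    (hV : V.FG) : ∃ S : Finset (GroupLike k H), 1 ∈ S ∧ ∀ m : ℕ,
      Module.finrank k ↥(∑ i ∈ Finset.range (m + 1), V ^ i) ≤ (S ^ m).card := by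
  classical
  obtain ⟨t, ht⟩ := hV
  have hex : ∀ x : groupSpan k H, ∃ c : GroupLike k H →₀ k,
      (c.sum fun i a => a • groupLikeToSpan k H i) = x := fun x =>
    Finsupp.mem_span_range_iff_exists_finsupp.1 (span_range_groupLikeToSpan (k := k) (H := H) ▸
      Submodule.mem_top)
  choose c hc using hex
  set S : Finset (GroupLike k H) := insert 1 (t.biUnion fun x => (c x).support) with hS
  have h1 : (1 : GroupLike k H) ∈ S := Finset.mem_insert_self _ _
  have hVS : V ≤ Submodule.span k (groupLikeToSpan k H '' (S : Set (GroupLike k H))) := by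
    rw [← ht, Submodule.span_le]
    intro x hx
    rw [SetLike.mem_coe, ← hc x]
    refine Submodule.sum_mem _ fun g hg => Submodule.smul_mem _ _ (Submodule.subset_span ⟨g, ?_, rfl⟩)
    exact Finset.mem_insert_of_mem (Finset.mem_biUnion.2 ⟨x, hx, hg⟩)
  refine ⟨S, h1, fun m => ?_⟩
  have hle : ∑ i ∈ Finset.range (m + 1), V ^ i ≤
      Submodule.span k (((S ^ m).image (groupLikeToSpan k H) : Finset _) : Set _) := by
    refine Finset.sum_induction _ (fun W => W ≤ _) (fun a b ha hb => sup_le ha hb) bot_le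
      fun i hi => ?_
    refine (pow_le_pow_left' hVS i).trans ?_
    rw [Submodule.span_pow, ← Set.image_pow, Finset.coe_image]
    refine Submodule.span_mono (Set.image_mono ?_)
    rw [← Finset.coe_pow]
    exact Finset.coe_subset.2 (Finset.pow_subset_pow_right h1
      (Nat.lt_succ_iff.1 (Finset.mem_range.1 hi)))
  exact (Submodule.finrank_mono hle).trans
    ((finrank_span_finset_le_card _).trans Finset.card_image_le)

theorem tendsto_log_div_log_mul (c : ℕ) :
    Tendsto (fun m : ℕ => Real.log m / Real.log (((c + 1) * m : ℕ) : ℝ)) atTop (𝓝 1) := by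
  have hlog : Tendsto (fun m : ℕ => Real.log (m : ℝ)) atTop atTop :=
    Real.tendsto_log_atTop.comp tendsto_natCast_atTop_atTop
  have h1 : Tendsto (fun m : ℕ => (1 + Real.log ((c + 1 : ℕ) : ℝ) / Real.log (m : ℝ))⁻¹) atTop
      (𝓝 1) := by
    have := ((hlog.const_div_atTop (Real.log ((c + 1 : ℕ) : ℝ))).const_add 1).inv₀ (by simp)
    simpa using this
  refine h1.congr' ?_
  filter_upwards [eventually_ge_atTop 2] with m hm
  have hm0 : (m : ℝ) ≠ 0 := by positivity
  have hlm : Real.log (m : ℝ) ≠ 0 := (Real.log_pos (by exact_mod_cast hm)).ne'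
  rw [Nat.cast_mul, Real.log_mul (by positivity) hm0]
  have hpos : 0 < Real.log ((c + 1 : ℕ) : ℝ) + Real.log (m : ℝ) :=
    add_pos_of_nonneg_of_pos (Real.log_natCast_nonneg _) (Real.log_pos (by exact_mod_cast hm))
  rw [eq_comm, inv_eq_one_div, div_eq_div_iff hpos.ne' (by
    rw [one_add_div hlm]
    exact div_ne_zero (by rw [add_comm]; exact hpos.ne') hlm)]
  field_simp
  ring

theorem ofReal_log_div_mul_le {c n m e d D : ℕ} (hm : 2 ≤ m) (hd : 0 < d) (hed : e ≤ d)
    (hD : m ^ n * d ≤ D) :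
    ENNReal.ofReal (Real.log m / Real.log (((c + 1) * m : ℕ) : ℝ)) *
        (ENNReal.ofReal (Real.logb m e) + n) ≤
      ENNReal.ofReal (Real.logb (((c + 1) * m : ℕ) : ℝ) D) := by
  have hm1 : (1 : ℝ) < m := by exact_mod_cast hm
  have hlm := Real.log_pos hm1
  have hd1 : (1 : ℝ) ≤ d := by exact_mod_cast hd
  have hlN : 0 < Real.log (((c + 1) * m : ℕ) : ℝ) := by
    apply Real.log_pos
    have : 2 ≤ (c + 1) * m := hm.trans (Nat.le_mul_of_pos_left _ c.succ_pos)
    exact_mod_cast this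
  have h1 : ENNReal.ofReal (Real.logb m e) + n ≤ ENNReal.ofReal (Real.logb m d + n) := by
    rw [ENNReal.ofReal_add (Real.logb_nonneg hm1 hd1) (Nat.cast_nonneg n), ENNReal.ofReal_natCast]
    refine add_le_add_left ?_ _
    rcases Nat.eq_zero_or_pos e with rfl | he
    · simp
    · apply ENNReal.ofReal_le_ofReal
      exact Real.logb_le_logb_of_le hm1 (Nat.cast_pos.2 he) (Nat.cast_le.2 hed)
  refine (mul_le_mul_right h1 _).trans ?_
  rw [← ENNReal.ofReal_mul (by positivity)]
  apply ENNReal.ofReal_le_ofReal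
  have h2 : Real.log m / Real.log (((c + 1) * m : ℕ) : ℝ) * (Real.logb m d + n) =
      Real.log ((m : ℝ) ^ n * d) / Real.log (((c + 1) * m : ℕ) : ℝ) := by
    rw [Real.log_mul (by positivity) (by positivity), Real.log_pow, Real.logb]
    field_simp
    ring
  rw [h2, Real.logb]
  gcongr
  exact_mod_cast hD

/-- Measuring dimension at `(c + 1) * m` instead of `m` is harmless, since the ratio of the
logarithms tends to 1; a subsequence suffices to bound a limsup from below. -/
theorem limsup_add_le_gkDim {A : Type*} [Ring A] [Algebra k A] {U : Submodule k A} (hU : U.FG)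
    {n c : ℕ} {e d : ℕ → ℕ} (hd : ∀ m, 0 < d m) (hed : ∀ m, e m ≤ d m)
    (hD : ∀ m, m ^ n * d m ≤
      Module.finrank k ↥(∑ i ∈ Finset.range ((c + 1) * m + 1), U ^ i)) :
    limsup (fun m : ℕ => ENNReal.ofReal (Real.logb m (e m))) atTop + n ≤ gkDim k A := by
  rw [← limsup_add_const atTop _ _ (by isBoundedDefault) (by isBoundedDefault)]
  refine le_of_forall_lt fun b hb => ?_
  obtain ⟨b₁, hb1, hb2⟩ := exists_between hb
  obtain ⟨b₂, hb3, hb4⟩ := exists_between hb2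
  refine hb1.trans_le ?_
  have hfreq := frequently_lt_of_lt_limsup (by isBoundedDefault) hb4
  have hev : ∀ᶠ m : ℕ in atTop, b₁ <
      ENNReal.ofReal (Real.log m / Real.log (((c + 1) * m : ℕ) : ℝ)) * b₂ := by
    have h1 := ENNReal.Tendsto.mul_const (b := b₂)
      (ENNReal.tendsto_ofReal (tendsto_log_div_log_mul c)) (Or.inr hb4.ne_top)
    rw [ENNReal.ofReal_one, one_mul] at h1
    exact h1.eventually_const_lt hb3
  refine le_gkDim_of_frequently hU ?_
  have ht : Tendsto (fun m : ℕ => (c + 1) * m) atTop atTop :=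
    tendsto_id.const_mul_atTop' c.succ_pos
  refine ht.frequently (((hfreq.and_eventually hev).and_eventually (eventually_ge_atTop 2)).mono ?_)
  rintro m ⟨⟨h1, h2⟩, h3⟩
  exact (h2.le.trans (mul_le_mul_right h1.le _)).trans
    (ofReal_log_div_mul_le h3 (hd m) (hed m) (hD m))

open scoped Pointwise in
theorem gkDim_groupSpan_add_le {n : ℕ} {g : Fin n → GroupLike k H} {y : Fin n → H}
    (hy : ∀ i, IsPrimitiveAt (g i) (y i))
    (hind : LinearIndependent k fun i => (Subalgebra.toSubmodule (groupSpan k H)).mkQ (y i))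
    (hgood : ∀ j b, SliceGood (g j) (y j) b) :
    gkDim k (groupSpan k H) + n ≤ gkDim k H := by
  classical
  rw [gkDim]
  rw [ENNReal.biSup_add' ⟨⊥, Submodule.fg_bot⟩]
  refine iSup₂_le fun V hV => ?_
  obtain ⟨S, hS1, hS⟩ := exists_finset_finrank_le hV
  set U : Submodule k H := Submodule.span k (Set.range y ∪ GroupLike.val '' (S : Set (GroupLike k H))) with hU
  have hUfg : U.FG :=
    Submodule.fg_span ((Set.finite_range y).union (S.finite_toSet.image _))
  have h1 : (1 : H) ∈ U := Submodule.subset_span (Or.inr ⟨1, hS1, rfl⟩)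
  have hyU : ∀ i, y i ∈ U ^ 1 := fun i => by
    rw [pow_one]
    exact Submodule.subset_span (Or.inl ⟨i, rfl⟩)
  have hSU : ∀ m : ℕ, ∀ h ∈ S ^ m, (h : H) ∈ U ^ m := by
    intro m h hh
    have h2 : GroupLike.valMonoidHom k H '' (S : Set (GroupLike k H)) ⊆ U := fun x hx =>
      Submodule.subset_span (Or.inr hx)
    refine Submodule.pow_subset_pow U (Set.pow_subset_pow_left h2 ?_)
    rw [← Set.image_pow]
    refine ⟨h, ?_, rfl⟩
    rw [← Finset.coe_pow]
    exact hh
  -- Exponents below `m` and group-likes from `S ^ m` give `m ^ n * |S ^ m|` independent products,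
  -- all in `U ^ ((n + 1) * m)`.
  refine limsup_add_le_gkDim hUfg (c := n) (d := fun m => (S ^ m).card)
    (fun m => Finset.card_pos.2 (Finset.Nonempty.pow ⟨1, hS1⟩)) hS fun m => ?_
  have hl := linearIndependent_mon_mul_coe hy hind (List.nodup_finRange n) List.mem_finRange
    (S := Set.univ) (fun a _ j b _ => hgood j b)
  have hl' := hl.comp (fun p : (Fin n → Fin m) × ↥(S ^ m) =>
    (⟨fun i => (p.1 i : ℕ), trivial⟩, p.2.1)) (fun p q hpq => by
      refine Prod.ext (funext fun i => Fin.ext ?_) (Subtype.ext (congrArg Prod.snd hpq))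
      exact congrFun (congrArg Subtype.val (congrArg Prod.fst hpq)) i)
  have h3 := card_le_finrank_sum_pow hUfg (m := (n + 1) * m) hl' fun p => by
    have h4 := mon_mem_pow hyU (List.finRange n) (fun i => (p.1 i : ℕ))
    have h5 := Submodule.mul_mem_mul h4 (hSU m p.2.1 p.2.2)
    rw [← pow_add] at h5
    refine pow_le_pow_of_one_mem h1 ?_ h5
    have := sum_map_finRange_le (m := m) (a := fun i => (p.1 i : ℕ)) (fun i => (p.1 i).2.le)
    linarith
  simpa using h3

/-- With exponents at most 1 only `sliceGood_zero` is needed, so no commutator has to exist. The `2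
^ n` squarefree monomials in `n` conjugates live in degree quadratic in `n`. -/
theorem gkDim_eq_top_of_conj_pow {g : GroupLike k H} {y : H} (hy : IsPrimitiveAt g y)
    (hind : LinearIndependent k fun n : ℕ =>
      (Subalgebra.toSubmodule (groupSpan k H)).mkQ ((conj g ^ n) y)) :
    gkDim k H = ⊤ := by
  classical
  set U : Submodule k H := Submodule.span k {1, (g : H), ((g⁻¹ : GroupLike k H) : H), y} with hU
  have hUfg : U.FG := Submodule.fg_span (by simp)
  have h1 : (1 : H) ∈ U := Submodule.subset_span (by simp)
  have hg : (g : H) ∈ U := Submodule.subset_span (by simp)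
  have hg' : ((g⁻¹ : GroupLike k H) : H) ∈ U := Submodule.subset_span (Or.inr (Or.inr (Or.inl rfl)))
  have hyU : y ∈ U := Submodule.subset_span (by simp)
  have hpow : ∀ i : ℕ, (conj g ^ i) y ∈ U ^ (2 * i + 1) := by
    intro i
    induction i with
    | zero => simpa using hyU
    | succ i ih =>
      rw [pow_succ' (conj g), Module.End.mul_apply, conj_apply,
        show 2 * (i + 1) + 1 = 1 + (2 * i + 1) + 1 by ring, pow_add, pow_add U 1, pow_one]
      exact Submodule.mul_mem_mul (Submodule.mul_mem_mul hg' ih) hg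
  -- Each of the first `n` conjugates lies in `U ^ (2 * n)`, and a squarefree monomial has at most
  -- `n` factors.
  have hcard : ∀ n : ℕ, 2 ^ n ≤
      Module.finrank k ↥(∑ i ∈ Finset.range (2 * n * (n * 1) + 1), U ^ i) := by
    intro n
    have hl := linearIndependent_mon_mul_coe (y := fun i : Fin n => (conj g ^ (i : ℕ)) y)
      (g := fun _ => g) (fun i => hy.conj_pow i) (hind.comp _ Fin.val_injective)
      (List.nodup_finRange n) (List.mem_finRange) (S := {a | ∀ j, a j < 2})
      (fun a ha j b hb => by
        obtain rfl : b = 0 := by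
          have : a j < 2 := ha j
          omega
        exact sliceGood_zero (hy.conj_pow j))
    have hl' := hl.comp (fun a : Fin n → Fin 2 => (⟨fun i => (a i : ℕ), fun i => (a i).2⟩, 1))
      (fun a b hab => by
        funext i
        exact Fin.ext (congrFun (congrArg Subtype.val (congrArg Prod.fst hab)) i))
    have := card_le_finrank_sum_pow hUfg (m := 2 * n * (n * 1)) hl' fun a => by
      simp only [Function.comp_apply, GroupLike.val_one, mul_one]
      have h3 := mon_mem_pow (r := 2 * n) (U := U) (y := fun i : Fin n => (conj g ^ (i : ℕ)) y)
        (fun i => pow_le_pow_of_one_mem h1 (by omega) (hpow i)) (List.finRange n)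
        (fun i => (a i : ℕ))
      refine pow_le_pow_of_one_mem h1 ?_ h3
      have := sum_map_finRange_le (m := 1) (a := fun i => (a i : ℕ)) (fun i => by omega)
      rw [mul_one] at this
      exact Nat.mul_le_mul_left _ this
    simpa using this
  refine ENNReal.eq_top_of_forall_nnreal_le fun r => ?_
  obtain ⟨c, hc⟩ := exists_nat_ge r
  refine le_trans (b := (c : ℝ≥0∞)) (by exact_mod_cast hc) (le_gkDim_of_frequently hUfg ?_)
  have ht : Tendsto (fun n : ℕ => 2 * n * (n * 1)) atTop atTop :=
    tendsto_atTop_mono (fun n => by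
      have := Nat.le_mul_self n
      simp only [id]
      nlinarith) tendsto_id
  refine ht.frequently (Eventually.frequently ?_)
  -- The goal amounts to `(2 * n ^ 2) ^ c ≤ 2 ^ n`; the threshold `(2 ^ c)⁻¹` absorbs the constant.
  have hlim := (tendsto_pow_const_div_const_pow_of_one_lt (2 * c) (one_lt_two (α := ℝ)))
  filter_upwards [hlim.eventually_lt_const (u := ((2 : ℝ) ^ c)⁻¹) (by positivity),
    eventually_ge_atTop 1] with n hn hn1
  rw [← ENNReal.ofReal_natCast]
  apply ENNReal.ofReal_le_ofReal
  have hn2 : (1 : ℝ) ≤ n := by exact_mod_cast hn1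
  have hb : (1 : ℝ) < (2 * n * (n * 1) : ℕ) := by
    push_cast
    nlinarith
  have hle : (2 : ℝ) ^ n ≤
      (Module.finrank k ↥(∑ i ∈ Finset.range (2 * n * (n * 1) + 1), U ^ i) : ℝ) := by
    exact_mod_cast hcard n
  rw [Real.le_logb_iff_rpow_le hb (lt_of_lt_of_le (by positivity) hle), Real.rpow_natCast]
  refine le_trans ?_ hle
  rw [div_lt_iff₀ (by positivity), ← div_eq_inv_mul, lt_div_iff₀ (by positivity)] at hn
  refine le_trans (le_of_eq ?_) hn.le
  push_cast
  rw [pow_mul, ← mul_pow]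
  ring

end Growth

/-! ### The lower bounds -/

section LowerBound

variable {k : Type*} [Field k] {H : Type*} [Ring H] [HopfAlgebra k H]

theorem geom_sum_inv_ne_zero [CharZero k] {γ : k} (h : γ = 1 ∨ ∀ n : ℕ, 0 < n → γ ^ n ≠ 1) (b : ℕ) :
    ∑ i ∈ Finset.range (b + 1), γ⁻¹ ^ i ≠ 0 := by
  rcases h with rfl | h
  · simpa using Nat.cast_add_one_ne_zero b
  · intro h0
    have h1 := geom_sum_mul γ⁻¹ (b + 1)
    rw [h0, zero_mul, eq_comm, sub_eq_zero, inv_pow, inv_eq_one] at h1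
    exact h _ b.succ_pos h1

theorem gkDim_groupSpan_add_natCast_le [CharZero k] {n : ℕ}
    (hn : (n : ℕ∞) ≤ (weightCommutators k H \ sqrtWeightCommutators k H).encard) :
    gkDim k (groupSpan k H) + n ≤ gkDim k H := by
  obtain ⟨t, hts, htn⟩ := Set.exists_subset_encard_eq hn
  have hfin : t.Finite := Set.finite_of_encard_eq_coe htn
  have := hfin.fintype
  have hcard : Fintype.card t = n := by
    rw [Set.encard_eq_coe_toFinset_card, Set.toFinset_card] at htn
    exact_mod_cast htn
  let e := (Fintype.equivFinOfCardEq hcard).symm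
  have hex : ∀ i : Fin n, ∃ y : H, IsPrimitiveAt (e i).1.1 y ∧ y ∉ groupSpan k H ∧
      conj (e i).1.1 y - ((e i).1.2 : k) • y ∈ groupSpan k H := fun i => by
    obtain ⟨y, hy, hyC, hc⟩ := (hts (e i).2).1
    exact ⟨y, hy, hyC, by rwa [conj_apply]⟩
  choose y hy hyC hc using hex
  refine gkDim_groupSpan_add_le hy (linearIndependent_mkQ_of_injective
    (Subtype.val_injective.comp e.injective) hy hyC hc) fun i b => ?_
  refine sliceGood_of_commutator (hy i) (e i).1.2.ne_zero (by simpa only [conj_apply] using hc i)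
    (geom_sum_inv_ne_zero ?_) b
  by_contra! hcon
  obtain ⟨h1, m, hm, h2⟩ := hcon
  exact (hts (e i).2).2 ⟨(hts (e i).2).1, fun h => h1 (by simp [h]), m, hm, Units.ext (by simpa using h2)⟩

theorem gkDim_groupSpan_add_encard_weightCommutators_le [CharZero k] :
    gkDim k (groupSpan k H) +
      ((weightCommutators k H \ sqrtWeightCommutators k H).encard : ℝ≥0∞) ≤ gkDim k H := by
  rcases h : (weightCommutators k H \ sqrtWeightCommutators k H).encard with _ | n
  -- An infinite set of pairs allows the finite bound for every natural number.
  · have htop : gkDim k H = ⊤ := by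
      refine ENNReal.eq_top_of_forall_nnreal_le fun r => ?_
      obtain ⟨c, hc⟩ := exists_nat_ge r
      refine le_trans (b := (c : ℝ≥0∞)) (by exact_mod_cast hc) ?_
      exact le_add_self.trans (gkDim_groupSpan_add_natCast_le (n := c) (h ▸ le_top))
    simp [htop]
  · exact gkDim_groupSpan_add_natCast_le (n := n) h.ge

theorem exists_commutator_or_gkDim_eq_top [IsAlgClosed k] {g : GroupLike k H}
    (hg : g ∈ weights k H \ sqrtWeights k H) :
    (∃ γ : kˣ, (g, γ) ∈ weightCommutators k H \ sqrtWeightCommutators k H) ∨ gkDim k H = ⊤ := by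
  rcases exists_commutator_or_linearIndependent hg.1 with ⟨γ, hγ⟩ | ⟨y, hy, hind⟩
  · refine Or.inl ⟨γ, hγ, ?_⟩
    rintro ⟨⟨y, hy, hyC, hc⟩, h1, n, hn, hγn⟩
    refine hg.2 (mem_sqrtWeights hy hyC (γ := (γ : k)) (by simpa only [conj_apply] using hc)
      (fun h => h1 (Units.ext h)) hn ?_)
    simpa using congrArg Units.val hγn
  · exact Or.inr (gkDim_eq_top_of_conj_pow hy hind)

end LowerBound

end SkewPrim

theorem theorem0p3 (k : Type*) [Field k] [IsAlgClosed k] [CharZero k]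
    (H : Type*) [Ring H] [HopfAlgebra k H]
    (hab : ∀ a ∈ Subgroup.closure (SkewPrim.weights k H \ SkewPrim.sqrtWeights k H),
      ∀ b ∈ Subgroup.closure (SkewPrim.weights k H \ SkewPrim.sqrtWeights k H), a * b = b * a) :
    SkewPrim.gkDim k (SkewPrim.groupSpan k H) +
        ((SkewPrim.weights k H \ SkewPrim.sqrtWeights k H).encard : ℝ≥0∞) ≤
      SkewPrim.gkDim k H ∧
    SkewPrim.gkDim k (SkewPrim.groupSpan k H) +
        ((SkewPrim.weightCommutators k H \ SkewPrim.sqrtWeightCommutators k H).encard : ℝ≥0∞) ≤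
      SkewPrim.gkDim k H := by
  have hΩ := SkewPrim.gkDim_groupSpan_add_encard_weightCommutators_le (k := k) (H := H)
  refine ⟨?_, hΩ⟩
  -- Finiteness of `GKdim H` excludes independent conjugates, so each weight in `W ∖ W_√` lifts to a
  -- pair in `Ω ∖ Ω_√`.
  by_cases htop : SkewPrim.gkDim k H = ⊤
  · simp [htop]
  refine le_trans ?_ hΩ
  have hsub : SkewPrim.weights k H \ SkewPrim.sqrtWeights k H ⊆
      Prod.fst '' (SkewPrim.weightCommutators k H \ SkewPrim.sqrtWeightCommutators k H) := by
    intro g hg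
    obtain ⟨γ, hγ⟩ := (SkewPrim.exists_commutator_or_gkDim_eq_top hg).resolve_right htop
    exact ⟨(g, γ), hγ, rfl⟩
  gcongr
  exact (Set.encard_le_encard hsub).trans (Set.encard_image_le _ _)
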